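/- Let $\mathbb{D}$ be the open unit disc and let $H^2(\mathbb{D})$ be the Hardy space of analytic functions $f(z)=\sum_{n\ge 0}a_nz^n$ on $\mathbb{D}$ with $\|f\|^2=\sum_{n\ge 0}|a_n|^2<\infty$. Fix $\alpha,\lambda\in\mathbb{C}$ with $|\alpha|=|\lambda|=1$ and let $\mathcal{C}_1$ be the conjugation $(\mathcal{C}_1f)(z)=\lambda\,\overline{f(\overline{\alpha z})}$ on $H^2(\mathbb{D})$. A bounded operator $T$ on $H^2(\mathbb{D})$ is called $\mathcal{C}_1$-symmetric if $T=\mathcal{C}_1T^*\mathcal{C}_1$. Let $\psi:\mathbb{D}\to\mathbb{C}$ be analytic and not identically zero, and let $\varphi:\mathbb{D}\to\mathbb{D}$ be analytic and nonconstant. Then the weighted composition operator $W_{\psi,\varphi}f=\psi\cdot(f\circ\varphi)$ is a bounded operator on $H^2(\mathbb{D})$ that is both $\mathcal{C}_1$-symmetric and normal if and only if there are $c_0,c_1\in\mathbb{C}$ with $|c_0|<1$, and with $|c_1|<1$ or ($c_0=0$ and $|c_1|=1$), such that for all $z\in\mathbb{D}$ $$\psi(z)=\frac{\psi(0)}{1-\alpha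 c_0z},\qquad \varphi(z)=\frac{(c_1-\alpha c_0^2)z+c_0}{1-\alpha c_0z},$$ and $$(\overline{c_0}-\alpha c_0)(1-|c_0|^2)+\alpha c_0\overline{c_1}-\overline{c_0}c_1=0.$$ In particular, if $\psi(0)=1$, then $\psi(z)=\dfrac{1}{1-\alpha c_0z}$. -/

import Mathlib

open scoped ComplexConjugate InnerProductSpace Complex.UnitDisc

noncomputable section

/-! ### The Hardy space of the unit disc -/

/-- The complex sequences that are square summable. -/
abbrev SquareSummableSeq : Type := lp (fun _ : ℕ => ℂ) 2

theorem summable_coeff_mul_pow {a : ℕ → ℂ} (ha : Summable fun n => ‖a n‖ ^ 2) (z : 𝔻) :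
    Summable fun n => a n * (z : ℂ) ^ n := by
  have h1 : Summable fun n => (‖(z : ℂ)‖ ^ 2) ^ n :=
    summable_geometric_of_lt_one (by positivity) z.sq_norm_lt_one
  refine Summable.of_norm_bounded (ha.add h1) fun n => ?_
  rw [norm_mul, norm_pow, ← pow_mul, mul_comm 2 n, pow_mul]
  nlinarith [sq_nonneg (‖a n‖ - ‖(z : ℂ)‖ ^ n), sq_nonneg ‖a n‖, sq_nonneg (‖(z : ℂ)‖ ^ n)]

theorem SquareSummableSeq.summable_sq (a : SquareSummableSeq) : Summable fun n => ‖a n‖ ^ 2 := by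
  have h := (memℓp_gen_iff (p := 2) (by simp)).1 (lp.memℓp a)
  simpa using h

/-- The vector space of the functions `f` on the unit disc that have an expansion
`f z = ∑ aₙ zⁿ` (so are analytic) with `∑ ‖aₙ‖ ^ 2 < ∞`. -/
def hardySubmodule : Submodule ℂ (𝔻 → ℂ) where
  carrier := {f | ∃ a : ℕ → ℂ, (Summable fun n => ‖a n‖ ^ 2) ∧
    ∀ z : 𝔻, HasSum (fun n => a n * (z : ℂ) ^ n) (f z)}
  zero_mem' := ⟨0, by simp, fun z => by simp⟩
  add_mem' := by
    rintro f g ⟨a, ha, hf⟩ ⟨b, hb, hg⟩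
    refine ⟨a + b, ?_, fun z => ?_⟩
    · refine Summable.of_nonneg_of_le (fun n => by positivity) (fun n => ?_)
        ((ha.add hb).mul_left 2)
      have h := norm_add_le (a n) (b n)
      simp only [Pi.add_apply]
      nlinarith [sq_nonneg (‖a n‖ - ‖b n‖), norm_nonneg (a n + b n)]
    · simpa [add_mul] using (hf z).add (hg z)
  smul_mem' := by
    rintro c f ⟨a, ha, hf⟩
    refine ⟨c • a, ?_, fun z => ?_⟩
    · simpa [mul_pow] using ha.mul_left (‖c‖ ^ 2)
    · simpa [mul_assoc] using (hf z).mul_left c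

/-- The Hardy space `H²(𝔻)`. -/
def HardySpace : Type := hardySubmodule

namespace HardySpace

instance : AddCommGroup HardySpace := inferInstanceAs (AddCommGroup hardySubmodule)

instance : Module ℂ HardySpace := inferInstanceAs (Module ℂ hardySubmodule)

instance : CoeFun HardySpace (fun _ => 𝔻 → ℂ) := ⟨fun f => f.1⟩

/-- The sum of a power series with square summable coefficients. -/
def ofCoeff : SquareSummableSeq →ₗ[ℂ] HardySpace where
  toFun a := ⟨fun z => ∑' n, a n * (z : ℂ) ^ n,
    a, a.summable_sq, fun z => (summable_coeff_mul_pow a.summable_sq z).hasSum⟩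
  map_add' a b := by
    refine Subtype.ext (funext fun z => ?_)
    have ha := summable_coeff_mul_pow a.summable_sq z
    have hb := summable_coeff_mul_pow b.summable_sq z
    exact (tsum_congr fun n => by simp [add_mul]).trans (ha.tsum_add hb)
  map_smul' c a := by
    refine Subtype.ext (funext fun z => ?_)
    exact (tsum_congr fun n => by simp [mul_assoc]).trans tsum_mul_left

theorem ofCoeff_bijective : Function.Bijective ofCoeff := by
  constructor
  · rw [injective_iff_map_eq_zero]
    intro a ha
    have hz : ∀ z : 𝔻, HasSum (fun n => a n * (z : ℂ) ^ n) 0 := fun z => by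
      have h := (summable_coeff_mul_pow a.summable_sq z).hasSum
      have h0 : (∑' n, a n * (z : ℂ) ^ n) = 0 := congrFun (congrArg Subtype.val ha) z
      rwa [h0] at h
    have hp : HasFPowerSeriesAt (fun _ : ℂ => (0 : ℂ))
        (FormalMultilinearSeries.ofScalars ℂ (fun n => a n)) 0 := by
      rw [hasFPowerSeriesAt_iff]
      filter_upwards [Metric.ball_mem_nhds (0 : ℂ) one_pos] with z hz1
      have h := hz (Complex.UnitDisc.mk z (by simpa using hz1))
      simpa [mul_comm] using h
    have h0 := hp.eq_zero
    ext n
    have h1 := congrArg (fun p => FormalMultilinearSeries.coeff p n) h0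
    rw [FormalMultilinearSeries.coeff_ofScalars] at h1
    exact h1
  · rintro ⟨f, a, ha, hf⟩
    refine ⟨⟨a, memℓp_gen (by simpa using ha)⟩, Subtype.ext (funext fun z => ?_)⟩
    exact (hf z).tsum_eq

/-- The sequence of Taylor coefficients at `0`, as a linear isomorphism onto `ℓ²`. -/
def coeff : HardySpace ≃ₗ[ℂ] SquareSummableSeq :=
  (LinearEquiv.ofBijective ofCoeff ofCoeff_bijective).symm

theorem hasSum_coeff (f : HardySpace) (z : 𝔻) :
    HasSum (fun n => coeff f n * (z : ℂ) ^ n) (f z) := by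
  have h := (summable_coeff_mul_pow (coeff f).summable_sq z).hasSum
  have h1 : ofCoeff (coeff f) = f :=
    (LinearEquiv.ofBijective ofCoeff ofCoeff_bijective).apply_symm_apply f
  have h2 : (∑' n, coeff f n * (z : ℂ) ^ n) = f z := congrFun (congrArg Subtype.val h1) z
  rwa [h2] at h

/-- The norm of `f` is the `ℓ²` norm of its Taylor coefficients. -/
instance : NormedAddCommGroup HardySpace :=
  NormedAddCommGroup.induced HardySpace SquareSummableSeq coeff coeff.injective

/-- The inner product of `f` and `g` is the `ℓ²` inner product of their Taylor coefficients. -/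
instance : InnerProductSpace ℂ HardySpace where
  norm_smul_le c f := by
    change ‖coeff (c • f)‖ ≤ ‖c‖ * ‖coeff f‖
    rw [map_smul, norm_smul]
  inner f g := ⟪coeff f, coeff g⟫_ℂ
  norm_sq_eq_re_inner f := norm_sq_eq_re_inner (𝕜 := ℂ) (coeff f)
  conj_inner_symm f g := inner_conj_symm (coeff f) (coeff g)
  add_left f g h := by rw [map_add, inner_add_left]
  smul_left f g c := by rw [map_smul, inner_smul_left]

theorem norm_sq_eq (f : HardySpace) : ‖f‖ ^ 2 = ∑' n, ‖coeff f n‖ ^ 2 := by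
  have h := lp.norm_rpow_eq_tsum (p := 2) (by simp) (coeff f)
  have h' : ‖coeff f‖ ^ 2 = ∑' n, ‖coeff f n‖ ^ 2 := by simpa using h
  exact h'

/-- The coefficient map as an isometry. -/
def coeffIsometry : HardySpace ≃ₗᵢ[ℂ] SquareSummableSeq :=
  ⟨coeff, fun _ => rfl⟩

instance : CompleteSpace HardySpace :=
  (completeSpace_congr (e := coeffIsometry.toEquiv)
    coeffIsometry.isometry.isUniformEmbedding).2 inferInstance

end HardySpace

/-! ### The conjugations and the operators -/

/-- The conjugation `f ↦ (z ↦ lam * conj (f (conj (α z))))` of the Hardy space,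
where `|α| = |lam| = 1`. -/
def conjC1 (α lam : Circle) (f : HardySpace) : HardySpace :=
  ⟨fun z => (lam : ℂ) * conj (f (star (α • z))), by
    refine ⟨fun n => (lam : ℂ) * (conj (HardySpace.coeff f n) * (α : ℂ) ^ n), ?_, fun z => ?_⟩
    · simpa only [norm_mul, norm_pow, Circle.norm_coe, RCLike.norm_conj, one_pow, one_mul, mul_one]
        using (HardySpace.coeff f).summable_sq
    · have h := (Complex.hasSum_conj'.2 (HardySpace.hasSum_coeff f (star (α • z)))).mul_left
        (lam : ℂ)
      simpa [mul_pow, mul_assoc] using h⟩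

/-- The bounded operator `T` is complex symmetric with respect to the conjugation
`conjC1 α lam`, that is, `T = C T* C` with `C = conjC1 α lam`. -/
def IsC1Symmetric (α lam : Circle) (T : HardySpace →L[ℂ] HardySpace) : Prop :=
  ∀ f, T f = conjC1 α lam (ContinuousLinearMap.adjoint T (conjC1 α lam f))

/-- The bounded operator `T` on the Hardy space is the weighted composition operator
`f ↦ ψ · (f ∘ φ)`. -/
def IsWeightedCompOp (ψ : 𝔻 → ℂ) (φ : 𝔻 → 𝔻) (T : HardySpace →L[ℂ] HardySpace) : Prop :=
  ∀ (f : HardySpace) (z : 𝔻), T f z = ψ z * f (φ z)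

/-- A function on the unit disc is holomorphic: it is the restriction of a function on `ℂ`
that is complex differentiable at each point of the disc. -/
def HolomorphicOnDisc (g : 𝔻 → ℂ) : Prop :=
  ∃ G : ℂ → ℂ, DifferentiableOn ℂ G (Metric.ball 0 1) ∧ ∀ z : 𝔻, G z = g z

end

/-! The kernels `kernel w` separate functions: `T*` sends `kernel w` to a multiple of `kernel (φ
w)`, and the conjugation permutes kernels up to scalars. So both properties of `T` become identities
in two points `z, w`. Symmetry says that `ψ z / (1 - α w φ z)` is symmetric in `z, w`
(`isC1Symmetric_iff`). Taking `w = 0` gives `ψ`; one further point gives a linear fractional `φ`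
(`linearFractional_of_symmetric`). Normality compares the kernels of `T T*` and `T* T`
(`isStarNormal_iff`), which reduces to the coefficient relation. The bound on `c₁ = φ'(0)` is the
Schwarz-Pick estimate (`norm_add_mul_sq_le`). Conversely, boundedness must be proved
(`exists_isWeightedCompOp`). A function of the backward shift has `kernel z` as eigenvector with
eigenvalue `conj (φ z)`; the orbits of this contraction give the adjoint of the operator. -/

namespace HardySpace

/-! ### Reproducing kernels and the backward shift -/

/-- The function with given square summable Taylor coefficients. -/
theorem exists_coeff_eq {a : ℕ → ℂ} (ha : Summable fun n => ‖a n‖ ^ 2) :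
    ∃ f : HardySpace, ∀ n, coeff f n = a n :=
  ⟨coeff.symm ⟨a, memℓp_gen (by simpa using ha)⟩, fun n => by
    rw [LinearEquiv.apply_symm_apply]⟩

theorem ext_coeff {f g : HardySpace} (h : ∀ n, coeff f n = coeff g n) : f = g :=
  coeff.injective (lp.ext (funext h))

theorem ext_apply {f g : HardySpace} (h : ∀ z : 𝔻, f z = g z) : f = g :=
  Subtype.ext (funext h)

theorem coeff_add (f g : HardySpace) (n : ℕ) : coeff (f + g) n = coeff f n + coeff g n := by
  rw [map_add]; rfl

theorem coeff_smul (c : ℂ) (f : HardySpace) (n : ℕ) : coeff (c • f) n = c * coeff f n := by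
  rw [map_smul]; rfl

theorem const_smul_apply (c : ℂ) (f : HardySpace) (z : 𝔻) : (c • f) z = c * f z := rfl

theorem summable_kernel (w : 𝔻) : Summable fun n => ‖conj (w : ℂ) ^ n‖ ^ 2 := by
  have h1 : Summable fun n => (‖(w : ℂ)‖ ^ 2) ^ n :=
    summable_geometric_of_lt_one (by positivity) w.sq_norm_lt_one
  refine h1.congr fun n => ?_
  rw [norm_pow, RCLike.norm_conj, ← pow_mul, ← pow_mul, mul_comm]

/-- The reproducing kernel of the Hardy space at `w`. -/
noncomputable def kernel (w : 𝔻) : HardySpace :=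
  coeff.symm ⟨fun n => conj (w : ℂ) ^ n, memℓp_gen (by simpa using summable_kernel w)⟩

theorem coeff_kernel (w : 𝔻) (n : ℕ) : coeff (kernel w) n = conj (w : ℂ) ^ n := by
  rw [kernel, LinearEquiv.apply_symm_apply]

theorem inner_kernel_left (w : 𝔻) (f : HardySpace) : ⟪kernel w, f⟫_ℂ = f w := by
  have h : HasSum (fun n => ⟪coeff (kernel w) n, coeff f n⟫_ℂ) ⟪kernel w, f⟫_ℂ :=
    lp.hasSum_inner (coeff (kernel w)) (coeff f)
  refine h.unique ((hasSum_coeff f w).congr_fun fun n => ?_)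
  simp [coeff_kernel]

theorem norm_mul_coe_lt_one (z w : 𝔻) : ‖(z : ℂ) * w‖ < 1 := by
  rw [norm_mul]
  nlinarith [z.norm_lt_one, w.norm_lt_one, norm_nonneg (z : ℂ), norm_nonneg (w : ℂ)]

theorem kernel_apply (w z : 𝔻) : kernel w z = (1 - conj (w : ℂ) * z)⁻¹ := by
  refine (hasSum_coeff (kernel w) z).unique ?_
  have h : ‖conj (w : ℂ) * z‖ < 1 := by
    rw [norm_mul, RCLike.norm_conj, ← norm_mul]; exact norm_mul_coe_lt_one w z
  refine (hasSum_geometric_of_norm_lt_one h).congr_fun fun n => ?_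
  rw [coeff_kernel, mul_pow]

theorem hasSum_norm_sq (f : HardySpace) : HasSum (fun n => ‖coeff f n‖ ^ 2) (‖f‖ ^ 2) := by
  rw [norm_sq_eq]
  exact (coeff f).summable_sq.hasSum

theorem coeff_zero (f : HardySpace) : coeff f 0 = f 0 := by
  have h := hasSum_coeff f 0
  simpa using (hasSum_single 0 fun n hn => by simp [hn]).unique h

/-- The backward shift on the Hardy space. -/
theorem exists_backwardShift : ∃ B : HardySpace →L[ℂ] HardySpace,
    (∀ z, B (kernel z) = conj (z : ℂ) • kernel z) ∧ ∀ f, ‖B f‖ ^ 2 + ‖f 0‖ ^ 2 = ‖f‖ ^ 2 := by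
  have hs (f : HardySpace) : Summable fun n => ‖coeff f (n + 1)‖ ^ 2 :=
    (summable_nat_add_iff 1).2 (coeff f).summable_sq
  choose b hb using fun f => exists_coeff_eq (hs f)
  have hn (f : HardySpace) : ‖b f‖ ^ 2 + ‖f 0‖ ^ 2 = ‖f‖ ^ 2 := by
    have h := hasSum_norm_sq (b f)
    simp only [hb] at h
    have h' := (hasSum_nat_add_iff (f := fun n => ‖coeff f n‖ ^ 2) 1).1 h
    simpa [coeff_zero] using h'.unique (hasSum_norm_sq f)
  refine ⟨LinearMap.mkContinuous
    { toFun := b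
      map_add' := fun f g => ext_coeff fun n => by simp only [hb, coeff_add]
      map_smul' := fun c f => ext_coeff fun n => by simp only [hb, coeff_smul, RingHom.id_apply] }
    1 fun f => ?_, fun z => ext_coeff fun n => ?_, hn⟩
  · rw [one_mul]
    refine (pow_le_pow_iff_left₀ (norm_nonneg _) (norm_nonneg _) two_ne_zero).1 ?_
    exact (le_add_of_nonneg_right (by positivity)).trans (hn f).le
  · refine (hb _ n).trans ?_
    rw [coeff_smul, coeff_kernel, coeff_kernel, pow_succ']

end HardySpace

/-! ### Boundedness for linear fractional symbols -/

namespace HardySpace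

/-- If `T` is a contraction and `ℓ` is dominated by its defect, then the sequences
`n ↦ ℓ (T ^ n h)` are square summable and depend boundedly on `h`. -/
theorem exists_coeff_eq_iterate (T : HardySpace →L[ℂ] HardySpace) (ℓ : HardySpace →L[ℂ] ℂ)
    (h : ∀ f, ‖T f‖ ^ 2 + ‖ℓ f‖ ^ 2 ≤ ‖f‖ ^ 2) :
    ∃ V : HardySpace →L[ℂ] HardySpace, ∀ f n, coeff (V f) n = ℓ ((T ^ n) f) := by
  -- The defect inequality at `T ^ n f` telescopes.
  have hsum (f : HardySpace) (N : ℕ) :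
      ∑ n ∈ Finset.range N, ‖ℓ ((T ^ n) f)‖ ^ 2 ≤ ‖f‖ ^ 2 - ‖(T ^ N) f‖ ^ 2 := by
    induction N with
    | zero => simp
    | succ N ih =>
      have h' := h ((T ^ N) f)
      have e : (T ^ (N + 1)) f = T ((T ^ N) f) := by rw [pow_succ']; rfl
      rw [Finset.sum_range_succ, e]
      linarith
  have hle (f : HardySpace) (N : ℕ) :
      ∑ n ∈ Finset.range N, ‖ℓ ((T ^ n) f)‖ ^ 2 ≤ ‖f‖ ^ 2 :=
    (hsum f N).trans (sub_le_self _ (by positivity))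
  have hs (f : HardySpace) : Summable fun n => ‖ℓ ((T ^ n) f)‖ ^ 2 :=
    summable_of_sum_range_le (fun n => by positivity) (hle f)
  choose v hv using fun f => exists_coeff_eq (hs f)
  refine ⟨LinearMap.mkContinuous
    { toFun := v
      map_add' := fun f g => ext_coeff fun n => by
        rw [coeff_add]; simp only [hv, map_add]
      map_smul' := fun c f => ext_coeff fun n => by
        rw [RingHom.id_apply, coeff_smul]; simp only [hv, map_smul, smul_eq_mul] }
    1 fun f => ?_, hv⟩
  rw [one_mul]
  refine (pow_le_pow_iff_left₀ (norm_nonneg _) (norm_nonneg _) two_ne_zero).1 ?_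
  change ‖v f‖ ^ 2 ≤ _
  rw [norm_sq_eq]
  simp only [hv]
  exact Real.tsum_le_of_sum_range_le (fun n => by positivity) (hle f)

end HardySpace

/-- A bound for a linear fractional self-map of the disc. -/
theorem two_mul_norm_le_of_selfMap {a c₀ c : ℂ} (ha : ‖a‖ = ‖c₀‖)
    (h : ∀ z : 𝔻, ‖c * z + c₀‖ ≤ ‖1 - a * z‖) :
    2 * ‖a + c * conj c₀‖ ≤ 1 - ‖c‖ ^ 2 := by
  set b := a + c * conj c₀ with hb
  -- The phase `u` makes the cross terms at `z = r u` add up to `r ‖b‖`, the extreme case.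
  obtain ⟨u, hu, hub⟩ : ∃ u : ℂ, ‖u‖ = 1 ∧ u * b = ‖b‖ := by
    by_cases h0 : b = 0
    · exact ⟨1, by simp, by simp [h0]⟩
    · have hn : (‖b‖ : ℂ) ≠ 0 := by simpa using h0
      refine ⟨conj b / ‖b‖, by simp [h0], ?_⟩
      rw [div_mul_eq_mul_div, Complex.conj_mul', sq, mul_div_assoc, div_self hn, mul_one]
  have hr : ∀ r ∈ Set.Ioo (0 : ℝ) 1,
      0 ≤ 1 - ‖c₀‖ ^ 2 + (‖c₀‖ ^ 2 - ‖c‖ ^ 2) * r ^ 2 - 2 * r * ‖b‖ := by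
    intro r hr
    have hz : ‖(r : ℂ) * u‖ < 1 := by
      rw [norm_mul, hu, mul_one, Complex.norm_real, Real.norm_of_nonneg hr.1.le]; exact hr.2
    have h1 := pow_le_pow_left₀ (norm_nonneg _) (h (Complex.UnitDisc.mk _ hz)) 2
    rw [Complex.UnitDisc.coe_mk, norm_add_sq (𝕜 := ℂ), norm_sub_sq (𝕜 := ℂ)] at h1
    have e1 : ‖c * (r * u)‖ ^ 2 = ‖c‖ ^ 2 * r ^ 2 := by
      simp [hu, mul_pow]
    have e2 : ‖a * (r * u)‖ ^ 2 = ‖c₀‖ ^ 2 * r ^ 2 := by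
      simp [hu, ha, mul_pow]
    have e3 : RCLike.re ⟪c * (r * u), c₀⟫_ℂ + RCLike.re ⟪1, a * (r * u)⟫_ℂ = r * ‖b‖ := by
      have e4 : (c * (r * u) * conj c₀) + a * (r * u) = ((r * ‖b‖ : ℝ) : ℂ) := by
        push_cast
        rw [← hub, hb]; ring
      rw [← inner_conj_symm, RCLike.conj_re, ← map_add]
      simp only [RCLike.inner_apply, map_one, mul_one]
      rw [e4]; simp
    rw [e1, e2] at h1
    simp only [norm_one] at h1
    linarith
  -- At `r = 1` the terms in `‖c₀‖ ^ 2` cancel.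
  have hc : Filter.Tendsto
      (fun r : ℝ => 1 - ‖c₀‖ ^ 2 + (‖c₀‖ ^ 2 - ‖c‖ ^ 2) * r ^ 2 - 2 * r * ‖b‖)
      (nhdsWithin 1 (Set.Iio 1))
      (nhds (1 - ‖c₀‖ ^ 2 + (‖c₀‖ ^ 2 - ‖c‖ ^ 2) * 1 ^ 2 - 2 * 1 * ‖b‖)) :=
    (Continuous.tendsto (by fun_prop) 1).mono_left nhdsWithin_le_nhds
  have := ge_of_tendsto hc (Filter.eventually_of_mem (Ioo_mem_nhdsLT zero_lt_one) hr)
  linarith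

/-- The strict inequality that goes with `two_mul_norm_le_of_selfMap`. -/
theorem two_mul_norm_sq_lt {a c₀ c : ℂ} (ha : ‖a‖ = ‖c₀‖) (hc₀ : ‖c₀‖ < 1)
    (h : 2 * ‖a + c * conj c₀‖ ≤ 1 - ‖c‖ ^ 2) : 2 * ‖c₀‖ ^ 2 < 1 + ‖c‖ ^ 2 := by
  have h1 : ‖c₀‖ - ‖c‖ * ‖c₀‖ ≤ ‖a + c * conj c₀‖ := by
    have := norm_sub_le (a + c * conj c₀) (c * conj c₀)
    rw [add_sub_cancel_right, ha, norm_mul, RCLike.norm_conj] at this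
    linarith
  have h0 := norm_nonneg c
  have h2 := norm_nonneg c₀
  have h3 : ‖c‖ ≤ 1 := by nlinarith [norm_nonneg (a + c * conj c₀)]
  rcases h3.eq_or_lt with h3 | h3
  · rw [h3]; nlinarith
  · have h4 : 2 * ‖c₀‖ ≤ 1 + ‖c‖ := by
      have : (1 - ‖c‖) * (2 * ‖c₀‖) ≤ (1 - ‖c‖) * (1 + ‖c‖) := by nlinarith
      exact le_of_mul_le_mul_left this (by linarith)
    nlinarith [mul_pos (sub_pos.2 h3) (sub_pos.2 h3)]

/-- A bound for the derivative at the origin of a linear fractional self-map. -/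
theorem norm_add_mul_sq_le {α : Circle} {c₀ c : ℂ} (hc₀ : ‖c₀‖ < 1)
    (h : 2 * ‖α * c₀ + c * conj c₀‖ ≤ 1 - ‖c‖ ^ 2) : ‖c + α * c₀ ^ 2‖ ≤ 1 - ‖c₀‖ ^ 2 := by
  have hlt := two_mul_norm_sq_lt (a := α * c₀)
    (by rw [norm_mul, Circle.norm_coe, one_mul]) hc₀ h
  have key : ‖c + α * c₀ ^ 2‖ ^ 2 =
      ‖α * c₀ + c * conj c₀‖ ^ 2 - (1 - ‖c₀‖ ^ 2) * (‖c₀‖ ^ 2 - ‖c‖ ^ 2) := by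
    have hα : (α : ℂ) * conj (α : ℂ) = 1 := by rw [Complex.mul_conj', Circle.norm_coe]; simp
    have : ((‖c + α * c₀ ^ 2‖ ^ 2 : ℝ) : ℂ) = ((‖α * c₀ + c * conj c₀‖ ^ 2 -
        (1 - ‖c₀‖ ^ 2) * (‖c₀‖ ^ 2 - ‖c‖ ^ 2) : ℝ) : ℂ) := by
      push_cast
      simp only [← Complex.mul_conj', map_add, map_mul, map_pow, Complex.conj_conj]
      linear_combination (c₀ ^ 2 * conj c₀ ^ 2 - c₀ * conj c₀) * hα
    exact_mod_cast this
  have h0 := norm_nonneg (α * c₀ + c * conj c₀)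
  -- Inserting `h` into `key` leaves a perfect square, whose root is nonnegative by `hlt`.
  have h5 : ‖c + α * c₀ ^ 2‖ ^ 2 ≤ ((1 + ‖c‖ ^ 2 - 2 * ‖c₀‖ ^ 2) / 2) ^ 2 := by
    nlinarith
  have h6 := (pow_le_pow_iff_left₀ (norm_nonneg _) (by linarith) two_ne_zero).1 h5
  linarith

/-- A quadratic form inequality. -/
theorem exists_pos_mul_sq_sub_sq_le {A e β : ℝ} (hA : 0 < A) (hAe : 0 < A - e)
    (h : 2 * β ≤ A + e) : ∃ ε > 0, ∀ x y : ℝ, 0 ≤ y → y ≤ x →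
      ε * (x ^ 2 - y ^ 2) ≤ A * x ^ 2 + e * y ^ 2 - 2 * β * (x * y) := by
  refine ⟨min A (A - e) / 2, by positivity, fun x y hy hx => ?_⟩
  have h1 := min_le_left A (A - e)
  have h2 := min_le_right A (A - e)
  set m := min A (A - e)
  -- Since `2 * β ≤ A + e`, the form is at least `(x - y) * (A * x - e * y)`; this bounds the second
  -- factor.
  have h3 : m / 2 * (x + y) ≤ A * x - e * y := by
    nlinarith [mul_nonneg hy (sub_nonneg.2 h2), mul_nonneg (sub_nonneg.2 hx) (sub_nonneg.2 h1),
      mul_nonneg (sub_nonneg.2 hx) hA.le]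
  have h4 := mul_le_mul_of_nonneg_left h3 (sub_nonneg.2 hx)
  have h5 := mul_le_mul_of_nonneg_right h (mul_nonneg (hy.trans hx) hy)
  nlinarith

theorem one_sub_mul_coe_ne_zero {a : ℂ} (ha : ‖a‖ < 1) (z : 𝔻) : 1 - a * z ≠ 0 := by
  intro h
  have h1 : ‖a * z‖ = 1 := by rw [← sub_eq_zero.1 h, norm_one]
  rw [norm_mul] at h1
  nlinarith [z.norm_lt_one, norm_nonneg (z : ℂ), norm_nonneg a]

namespace HardySpace

/-- The Hilbert space inequality behind the boundedness of composition with a linear fractional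
self-map. -/
theorem exists_pos_norm_sq_add_le {a c₀ c : ℂ} (ha : ‖a‖ = ‖c₀‖) (hc₀ : ‖c₀‖ < 1)
    (h : 2 * ‖a + c * conj c₀‖ ≤ 1 - ‖c‖ ^ 2) {B : HardySpace →L[ℂ] HardySpace}
    (hB : ∀ f, ‖B f‖ ^ 2 + ‖f 0‖ ^ 2 = ‖f‖ ^ 2) :
    ∃ ε > 0, ∀ g, ‖conj c₀ • g + conj c • B g‖ ^ 2 + ε * ‖g 0‖ ^ 2 ≤
      ‖g - conj a • B g‖ ^ 2 := by
  have hlt := two_mul_norm_sq_lt ha hc₀ h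
  obtain ⟨ε, hε, hq⟩ := exists_pos_mul_sq_sub_sq_le (A := 1 - ‖c₀‖ ^ 2)
    (e := ‖c₀‖ ^ 2 - ‖c‖ ^ 2) (β := ‖a + c * conj c₀‖)
    (by nlinarith [norm_nonneg c₀]) (by linarith) (by linarith)
  refine ⟨ε, hε, fun g => ?_⟩
  have hBg : ‖B g‖ ≤ ‖g‖ :=
    (pow_le_pow_iff_left₀ (norm_nonneg _) (norm_nonneg _) two_ne_zero).1
      ((le_add_of_nonneg_right (by positivity)).trans (hB g).le)
  -- Here `x ^ 2 - y ^ 2` is `‖g 0‖ ^ 2`, by `hB`.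
  have h1 := hq ‖g‖ ‖B g‖ (norm_nonneg _) hBg
  have h2 : RCLike.re ⟪conj c₀ • g, conj c • B g⟫_ℂ + RCLike.re ⟪g, conj a • B g⟫_ℂ ≤
      ‖a + c * conj c₀‖ * (‖g‖ * ‖B g‖) := by
    have e : ⟪conj c₀ • g, conj c • B g⟫_ℂ + ⟪g, conj a • B g⟫_ℂ =
        conj (a + c * conj c₀) * ⟪g, B g⟫_ℂ := by
      simp only [inner_smul_left, inner_smul_right, map_add, map_mul, Complex.conj_conj]
      ring
    rw [← map_add, e]
    refine (RCLike.re_le_norm _).trans ?_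
    rw [norm_mul, RCLike.norm_conj]
    exact mul_le_mul_of_nonneg_left (norm_inner_le_norm _ _) (norm_nonneg _)
  rw [norm_add_sq (𝕜 := ℂ), norm_sub_sq (𝕜 := ℂ)]
  simp only [norm_smul, RCLike.norm_conj, mul_pow, ha]
  have h3 := hB g
  nlinarith

end HardySpace

open HardySpace in
/-- A weighted composition operator whose symbol is a linear fractional self-map of the disc and
whose weight has the matching denominator is bounded. -/
theorem exists_isWeightedCompOp {ψ : 𝔻 → ℂ} {φ : 𝔻 → 𝔻} {a c₀ c : ℂ} (ha : ‖a‖ = ‖c₀‖)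
    (hc₀ : ‖c₀‖ < 1) (hψ : ∀ z, ψ z = ψ 0 / (1 - a * z))
    (hφ : ∀ z, (φ z : ℂ) = (c * z + c₀) / (1 - a * z)) :
    ∃ T : HardySpace →L[ℂ] HardySpace, IsWeightedCompOp ψ φ T := by
  have hne (z : 𝔻) : 1 - a * z ≠ 0 := one_sub_mul_coe_ne_zero (ha.trans_lt hc₀) z
  have hself : 2 * ‖a + c * conj c₀‖ ≤ 1 - ‖c‖ ^ 2 :=
    two_mul_norm_le_of_selfMap ha fun z => by
      have h1 := (φ z).norm_lt_one.le
      rwa [hφ, norm_div, div_le_one (norm_pos_iff.2 (hne z))] at h1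
  obtain ⟨B, hBk, hB⟩ := exists_backwardShift
  obtain ⟨ε, hε, hle⟩ := exists_pos_norm_sq_add_le ha hc₀ hself hB
  have hB1 : ‖B‖ ≤ 1 := B.opNorm_le_bound zero_le_one fun f => by
    rw [one_mul]
    exact (pow_le_pow_iff_left₀ (norm_nonneg _) (norm_nonneg _) two_ne_zero).1
      ((le_add_of_nonneg_right (by positivity)).trans (hB f).le)
  have hlt : ‖conj a • B‖ < 1 := by
    rw [norm_smul, RCLike.norm_conj, ha]
    nlinarith [norm_nonneg B, norm_nonneg c₀]
  set u : (HardySpace →L[ℂ] HardySpace)ˣ := Units.oneSub (conj a • B) hlt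
  have hX (g : HardySpace) : (u : HardySpace →L[ℂ] HardySpace) g = g - conj a • B g := rfl
  set R : HardySpace →L[ℂ] HardySpace := ↑u⁻¹ with hR
  have hRX (f : HardySpace) : R ((u : HardySpace →L[ℂ] HardySpace) f) = f :=
    DFunLike.congr_fun u.inv_mul f
  have hXR (f : HardySpace) : (u : HardySpace →L[ℂ] HardySpace) (R f) = f :=
    DFunLike.congr_fun u.mul_inv f
  have hRk (z : 𝔻) : R (kernel z) = (conj (1 - a * z))⁻¹ • kernel z := by
    have h1 : (u : HardySpace →L[ℂ] HardySpace) (kernel z) = conj (1 - a * z) • kernel z := by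
      rw [hX, hBk]
      simp only [map_sub, map_one, map_mul, sub_smul, one_smul, smul_smul]
    have h2 := hRX (kernel z)
    rw [h1, map_smul] at h2
    rw [eq_inv_smul_iff₀ ((map_ne_zero _).2 (hne z)), h2]
  -- A linear fractional function of `B`, built to act on kernels as the adjoint of multiplication
  -- by `φ`.
  set T : HardySpace →L[ℂ] HardySpace :=
    (conj c₀ • (1 : HardySpace →L[ℂ] HardySpace) + conj c • B) * R
  have hT (f : HardySpace) : T f = conj c₀ • R f + conj c • B (R f) := rfl
  have hTk (z : 𝔻) : T (kernel z) = conj (φ z : ℂ) • kernel z := by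
    rw [hT, hRk, map_smul, hBk, smul_smul, smul_smul, smul_smul, ← add_smul, hφ, map_div₀]
    congr 1
    simp only [map_add, map_mul, div_eq_mul_inv]
    ring
  have hTnk (n : ℕ) (z : 𝔻) : (T ^ n) (kernel z) = conj (φ z : ℂ) ^ n • kernel z := by
    induction n with
    | zero => simp
    | succ n ih =>
      have e : (T ^ (n + 1)) (kernel z) = T ((T ^ n) (kernel z)) := by rw [pow_succ']; rfl
      rw [e, ih, map_smul, hTk, smul_smul, pow_succ]
  -- The factor `√ε` makes `‖ℓ f‖ ^ 2` the defect term of `hle` at `R f`.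
  set ℓ : HardySpace →L[ℂ] ℂ := ((√ε : ℝ) : ℂ) • (innerSL ℂ (kernel 0)).comp R
  have hℓ (f : HardySpace) : ℓ f = (√ε : ℝ) * (R f) 0 :=
    congrArg (((√ε : ℝ) : ℂ) * ·) (inner_kernel_left 0 (R f))
  obtain ⟨V, hV⟩ := exists_coeff_eq_iterate T ℓ fun f => by
    have h1 := hle (R f)
    rw [← hX, hXR] at h1
    rw [hT, hℓ, norm_mul, mul_pow, Complex.norm_real, Real.norm_of_nonneg (Real.sqrt_nonneg ε),
      Real.sq_sqrt hε.le]
    exact h1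
  -- The powers `conj (φ z) ^ n` produced by the iterates are the coefficients of `kernel (φ z)`.
  have hVk (z : 𝔻) :
      V (kernel z) = (((√ε : ℝ) : ℂ) * (conj (1 - a * z))⁻¹) • kernel (φ z) := by
    refine ext_coeff fun n => ?_
    rw [hV, hTnk, map_smul, hℓ, hRk, coeff_smul, coeff_kernel, const_smul_apply, kernel_apply]
    simp
    ring
  refine ⟨(ψ 0 / (√ε : ℝ)) • ContinuousLinearMap.adjoint V, fun f z => ?_⟩
  have h1 : ContinuousLinearMap.adjoint V f z = (√ε : ℝ) * (1 - a * z)⁻¹ * f (φ z) := by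
    rw [← inner_kernel_left z, ContinuousLinearMap.adjoint_inner_right, hVk, inner_smul_left,
      inner_kernel_left]
    simp
  have h2 : ((√ε : ℝ) : ℂ) ≠ 0 := by exact_mod_cast (Real.sqrt_pos.2 hε).ne'
  change ψ 0 / (√ε : ℝ) * ContinuousLinearMap.adjoint V f z = _
  rw [h1, hψ z]
  field_simp

/-! ### Symmetry and normality tested on kernels -/

namespace HardySpace

theorem circle_conj_mul_self (α : Circle) : conj (α : ℂ) * (α : ℂ) = 1 := by
  rw [Complex.conj_mul', Circle.norm_coe]; simp

theorem coe_star_smul (α : Circle) (z : 𝔻) : ((star (α • z) : 𝔻) : ℂ) = conj (α * z : ℂ) := by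
  simp

theorem star_smul_star_smul (α : Circle) (z : 𝔻) : star (α • star (α • z)) = z := by
  apply Complex.UnitDisc.coe_injective
  rw [coe_star_smul, coe_star_smul, map_mul, Complex.conj_conj, ← mul_assoc,
    circle_conj_mul_self, one_mul]

theorem conjC1_apply (α lam : Circle) (f : HardySpace) (z : 𝔻) :
    conjC1 α lam f z = lam * conj (f (star (α • z))) := rfl

theorem kernel_star_smul_apply (α : Circle) (w z : 𝔻) :
    kernel (star (α • w)) z = (1 - (α : ℂ) * w * z)⁻¹ := by
  rw [kernel_apply, coe_star_smul, Complex.conj_conj]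

theorem conj_kernel_apply_star_smul (α : Circle) (w z : 𝔻) :
    conj (kernel w (star (α • z))) = (1 - (α : ℂ) * w * z)⁻¹ := by
  rw [kernel_apply, coe_star_smul, ← map_mul, map_inv₀, map_sub, Complex.conj_conj, map_one]
  ring

theorem conjC1_kernel_star_smul (α lam : Circle) (w : 𝔻) :
    conjC1 α lam (kernel (star (α • w))) = (lam : ℂ) • kernel w := by
  refine ext_apply fun z => ?_
  rw [conjC1_apply, const_smul_apply, conj_kernel_apply_star_smul, kernel_apply, coe_star_smul,
    map_mul, ← mul_assoc, mul_comm (α : ℂ), circle_conj_mul_self, one_mul]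

end HardySpace

namespace IsWeightedCompOp

open HardySpace

variable {α lam : Circle} {ψ : 𝔻 → ℂ} {φ : 𝔻 → 𝔻} {T : HardySpace →L[ℂ] HardySpace}

theorem adjoint_kernel (hT : IsWeightedCompOp ψ φ T) (w : 𝔻) :
    ContinuousLinearMap.adjoint T (kernel w) = conj (ψ w) • kernel (φ w) := by
  refine ext_inner_right ℂ fun f => ?_
  rw [ContinuousLinearMap.adjoint_inner_left, inner_kernel_left, hT, inner_smul_left,
    inner_kernel_left, Complex.conj_conj]

/-- The forward direction tests on `kernel (star (α • w))`, which the conjugation turns into a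
multiple of `kernel w`. Backward, the identity computes `T` on these kernels, hence `T*` paired with
them. -/
theorem isC1Symmetric_iff (hT : IsWeightedCompOp ψ φ T) :
    IsC1Symmetric α lam T ↔
      ∀ z w : 𝔻, ψ z * (1 - (α : ℂ) * w * φ z)⁻¹ = ψ w * (1 - (α : ℂ) * φ w * z)⁻¹ := by
  have hlam : (lam : ℂ) * conj (lam : ℂ) = 1 := by rw [mul_comm, circle_conj_mul_self]
  constructor
  · intro h z w
    have h1 := h (kernel (star (α • w)))
    have h2 : T (kernel (star (α • w))) z = _ := congrArg (fun f : HardySpace => f z) h1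
    rw [hT, kernel_star_smul_apply] at h2
    rw [h2, conjC1_kernel_star_smul, map_smul, hT.adjoint_kernel, conjC1_apply, const_smul_apply,
      const_smul_apply, map_mul, map_mul, conj_kernel_apply_star_smul, Complex.conj_conj, ← mul_assoc,
      hlam, one_mul]
  · intro h f
    refine ext_apply fun z => ?_
    have hk : T (kernel (star (α • z))) = ψ z • kernel (star (α • φ z)) := by
      refine ext_apply fun ζ => ?_
      rw [hT, kernel_star_smul_apply, const_smul_apply, kernel_star_smul_apply, h ζ z]
    rw [hT, conjC1_apply, ← inner_kernel_left (star (α • z)), ContinuousLinearMap.adjoint_inner_right, hk,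
      inner_smul_left, inner_kernel_left, conjC1_apply, star_smul_star_smul, map_mul, map_mul,
      Complex.conj_conj, Complex.conj_conj]
    linear_combination (-ψ z * f (φ z)) * hlam

theorem isStarNormal_iff (hT : IsWeightedCompOp ψ φ T) (hS : IsC1Symmetric α lam T) :
    IsStarNormal T ↔ ∀ z w : 𝔻,
      conj (ψ w) * ψ z * (1 - conj (φ w : ℂ) * φ z)⁻¹ =
        ψ (star (α • w)) * conj (ψ (star (α • z))) *
          (1 - φ (star (α • w)) * conj (φ (star (α • z)) : ℂ))⁻¹ := by
  -- Symmetry makes `T`, like `T*`, send kernels to multiples of kernels.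
  have hk (w : 𝔻) : T (kernel w) = ψ (star (α • w)) • kernel (star (α • φ (star (α • w)))) := by
    refine ext_apply fun ζ => ?_
    rw [const_smul_apply, kernel_star_smul_apply, ← hT.isC1Symmetric_iff.1 hS ζ, hT,
      ← kernel_star_smul_apply, star_smul_star_smul]
  have h1 (z w : 𝔻) : ⟪kernel z, T (ContinuousLinearMap.adjoint T (kernel w))⟫_ℂ =
      conj (ψ w) * ψ z * (1 - conj (φ w : ℂ) * φ z)⁻¹ := by
    rw [inner_kernel_left, hT, hT.adjoint_kernel, const_smul_apply, kernel_apply]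
    ring
  have h2 (z w : 𝔻) : ⟪kernel z, ContinuousLinearMap.adjoint T (T (kernel w))⟫_ℂ =
      ψ (star (α • w)) * conj (ψ (star (α • z))) *
          (1 - φ (star (α • w)) * conj (φ (star (α • z)) : ℂ))⁻¹ := by
    rw [ContinuousLinearMap.adjoint_inner_right, hk, hk, inner_smul_left, inner_smul_right,
      inner_kernel_left, kernel_star_smul_apply, coe_star_smul, map_mul]
    have : (α : ℂ) * φ (star (α • w)) * (conj (α : ℂ) * conj (φ (star (α • z)) : ℂ)) =
        φ (star (α • w)) * conj (φ (star (α • z)) : ℂ) := by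
      linear_combination (φ (star (α • w)) * conj (φ (star (α • z)) : ℂ)) *
        circle_conj_mul_self α
    rw [this]
    ring
  constructor
  · intro hN z w
    have h := DFunLike.congr_fun hN.star_comm_self.eq (kernel w)
    rw [← h1, ← h2]
    exact congrArg (fun f => ⟪kernel z, f⟫_ℂ) h.symm
  · intro h
    have h3 (w : 𝔻) : T (ContinuousLinearMap.adjoint T (kernel w)) =
        ContinuousLinearMap.adjoint T (T (kernel w)) := by
      refine ext_apply fun z => ?_
      rw [← inner_kernel_left, ← inner_kernel_left, h1, h2, h]
    refine ⟨ContinuousLinearMap.ext fun f => ext_apply fun w => ?_⟩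
    change ContinuousLinearMap.adjoint T (T f) w = T (ContinuousLinearMap.adjoint T f) w
    rw [← inner_kernel_left, ← inner_kernel_left, ContinuousLinearMap.adjoint_inner_right,
      ← ContinuousLinearMap.adjoint_inner_left T, ← h3,
      ← ContinuousLinearMap.adjoint_inner_left T, ContinuousLinearMap.adjoint_inner_right]

end IsWeightedCompOp

/-! ### Linear fractional symbols and the coefficient relation -/

theorem norm_circle_mul (α : Circle) (c : ℂ) : ‖α * c‖ = ‖c‖ := by
  rw [norm_mul, Circle.norm_coe, one_mul]

/-- The kernel of `T T*` for a weighted composition operator with linear fractional symbol. -/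
theorem conj_mul_mul_inv_eq {ψ : 𝔻 → ℂ} {φ : 𝔻 → 𝔻} {a c₀ c : ℂ} (ha : ‖a‖ < 1)
    (hψ : ∀ z, ψ z = ψ 0 / (1 - a * z)) (hφ : ∀ z, (φ z : ℂ) = (c * z + c₀) / (1 - a * z))
    (z w : 𝔻) :
    conj (ψ w) * ψ z * (1 - conj (φ w : ℂ) * φ z)⁻¹ = conj (ψ 0) * ψ 0 *
      ((1 - a * z) * conj (1 - a * w) - (c * z + c₀) * conj (c * w + c₀))⁻¹ := by
  have hz := one_sub_mul_coe_ne_zero ha z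
  have hw : conj (1 - a * w) ≠ 0 := (map_ne_zero _).2 (one_sub_mul_coe_ne_zero ha w)
  have e : (1 - a * z) * conj (1 - a * w) - (c * z + c₀) * conj (c * w + c₀) =
      (1 - a * z) * conj (1 - a * w) * (1 - conj (φ w : ℂ) * φ z) := by
    rw [hφ z, hφ w, map_div₀]
    field_simp
  rw [e, hψ z, hψ w, map_div₀, mul_inv, mul_inv]
  field_simp

/-- Two forms of the relation between the coefficients of a normal symbol. -/
theorem coeff_relation_iff (α : Circle) (c₀ c₁ : ℂ) :
    (conj c₀ - α * c₀) * (1 - (‖c₀‖ : ℂ) ^ 2) + α * c₀ * conj c₁ - conj c₀ * c₁ = 0 ↔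
      α * c₀ + conj c₀ * (c₁ - α * c₀ ^ 2) =
        conj c₀ + α * c₀ * conj (c₁ - α * c₀ ^ 2) := by
  have hα := HardySpace.circle_conj_mul_self α
  rw [← Complex.mul_conj', map_sub, map_mul, map_pow]
  constructor <;> intro h
  · linear_combination (c₀ * conj c₀ ^ 2) * hα - h
  · linear_combination (c₀ * conj c₀ ^ 2) * hα - h

/-- A function on the disc that is symmetric in the sense of `isC1Symmetric_iff` has the stated
linear fractional form. -/
theorem linearFractional_of_symmetric {α : Circle} {ψ : 𝔻 → ℂ} {φ : 𝔻 → 𝔻}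
    (hψ0 : ∃ z, ψ z ≠ 0)
    (h : ∀ z w : 𝔻, ψ z * (1 - (α : ℂ) * w * φ z)⁻¹ = ψ w * (1 - (α : ℂ) * φ w * z)⁻¹) :
    ψ 0 ≠ 0 ∧ (∀ z, ψ z = ψ 0 / (1 - α * φ 0 * z)) ∧
      ∃ c : ℂ, ∀ z, (φ z : ℂ) = (c * z + φ 0) / (1 - α * φ 0 * z) := by
  have hψ (z : 𝔻) : ψ z = ψ 0 / (1 - α * φ 0 * z) := by simpa [div_eq_mul_inv] using h z 0
  have h0 : ψ 0 ≠ 0 := by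
    obtain ⟨z, hz⟩ := hψ0
    intro h0
    rw [hψ, h0, zero_div] at hz
    exact hz rfl
  refine ⟨h0, hψ, ?_⟩
  have hne (x z : 𝔻) : 1 - (α : ℂ) * x * z ≠ 0 :=
    one_sub_mul_coe_ne_zero (by rw [norm_circle_mul]; exact x.norm_lt_one) z
  obtain ⟨p, hp⟩ : ∃ p : 𝔻, (p : ℂ) ≠ 0 := ⟨Complex.UnitDisc.mk (1 / 2) (by norm_num), by simp⟩
  -- The value of `c` is forced by the formula at `p`.
  refine ⟨(φ p * (1 - α * φ 0 * p) - φ 0) / p, fun z => ?_⟩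
  have h1 := h z p
  rw [hψ z, hψ p, ← div_eq_mul_inv, ← div_eq_mul_inv, div_div, div_div,
    div_eq_div_iff (mul_ne_zero (hne _ _) (hne _ _)) (mul_ne_zero (hne _ _) (hne _ _))] at h1
  have h2 := mul_left_cancel₀ h0 h1
  have h3 : (p : ℂ) * (φ z * (1 - α * φ 0 * z)) =
      (φ p * (1 - α * φ 0 * p) - φ 0) * z + φ 0 * p := by
    refine mul_left_cancel₀ α.coe_ne_zero ?_
    linear_combination h2
  rw [eq_div_iff (hne _ _)]
  refine mul_left_cancel₀ hp ?_
  rw [h3]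
  field_simp

open HardySpace in
theorem mainTheorem1 (α lam : Circle) (ψ : 𝔻 → ℂ) (φ : 𝔻 → 𝔻)
    (hψ : HolomorphicOnDisc ψ) (hφ : HolomorphicOnDisc fun z => (φ z : ℂ))
    (hψ0 : ∃ z, ψ z ≠ 0) (hφc : ¬ ∃ w, ∀ z, φ z = w) :
    (∃ T : HardySpace →L[ℂ] HardySpace,
        IsWeightedCompOp ψ φ T ∧ IsC1Symmetric α lam T ∧ IsStarNormal T) ↔
      ∃ c₀ c₁ : ℂ, ‖c₀‖ < 1 ∧ (‖c₁‖ < 1 ∨ (c₀ = 0 ∧ ‖c₁‖ = 1)) ∧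
        (∀ z : 𝔻, ψ z = ψ 0 / (1 - α * c₀ * z)) ∧
        (∀ z : 𝔻, (φ z : ℂ) = ((c₁ - α * c₀ ^ 2) * z + c₀) / (1 - α * c₀ * z)) ∧
        (conj c₀ - α * c₀) * (1 - (‖c₀‖ : ℂ) ^ 2) + α * c₀ * conj c₁ - conj c₀ * c₁ = 0 := by
  have hα := circle_conj_mul_self α
  constructor
  · rintro ⟨T, hT, hS, hN⟩
    obtain ⟨h0, h1, c, h2⟩ := linearFractional_of_symmetric hψ0 (hT.isC1Symmetric_iff.1 hS)
    have hlt : ‖(φ 0 : ℂ)‖ < 1 := (φ 0).norm_lt_one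
    have hanorm := norm_circle_mul α (φ 0)
    have halt := hanorm.trans_lt hlt
    have hself : 2 * ‖(α : ℂ) * φ 0 + c * conj (φ 0 : ℂ)‖ ≤ 1 - ‖c‖ ^ 2 :=
      two_mul_norm_le_of_selfMap hanorm fun z => by
        have h3 := (φ z).norm_lt_one.le
        rwa [h2, norm_div, div_le_one (norm_pos_iff.2 (one_sub_mul_coe_ne_zero halt z))] at h3
    have hc₁ := norm_add_mul_sq_le hlt hself
    refine ⟨φ 0, c + α * φ 0 ^ 2, hlt, ?_, h1, by simpa using h2, ?_⟩
    · by_cases hz : (φ 0 : ℂ) = 0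
      · rw [hz, norm_zero] at hc₁
        rcases (show ‖c + α * 0 ^ 2‖ ≤ 1 by linarith).lt_or_eq with h | h
        · exact Or.inl (by rwa [hz])
        · exact Or.inr ⟨hz, by rwa [hz]⟩
      · have := norm_pos_iff.2 hz
        exact Or.inl (by nlinarith)
    · rw [coeff_relation_iff, add_sub_cancel_right]
      obtain ⟨p, hp⟩ : ∃ p : 𝔻, (p : ℂ) ≠ 0 :=
        ⟨Complex.UnitDisc.mk (1 / 2) (by norm_num), by simp⟩
      -- With `w = 0` the identity is affine in `p`; its linear coefficient is the relation sought.
      have h3 := (hT.isStarNormal_iff hS).1 hN p 0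
      rw [conj_mul_mul_inv_eq halt h1 h2, mul_comm (ψ (star (α • 0))), mul_comm (φ _ : ℂ),
        conj_mul_mul_inv_eq halt h1 h2] at h3
      have h4 := inv_injective (mul_left_cancel₀ (mul_ne_zero ((map_ne_zero _).2 h0) h0) h3)
      simp only [coe_star_smul, map_mul, map_sub, map_add, map_one, map_zero, Complex.conj_conj,
        Complex.UnitDisc.coe_zero] at h4
      refine mul_left_cancel₀ hp ?_
      linear_combination -h4 + (p * conj (φ 0 : ℂ)) * hα
  · rintro ⟨c₀, c₁, hc₀, -, h1, h2, h3⟩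
    have hanorm := norm_circle_mul α c₀
    have halt := hanorm.trans_lt hc₀
    obtain ⟨T, hT⟩ := exists_isWeightedCompOp hanorm hc₀ h1 h2
    have hS : IsC1Symmetric α lam T := by
      rw [hT.isC1Symmetric_iff]
      intro z w
      have hz := one_sub_mul_coe_ne_zero halt z
      have hw := one_sub_mul_coe_ne_zero halt w
      rw [h1 z, h1 w, ← div_eq_mul_inv, ← div_eq_mul_inv, div_div, div_div, h2 z, h2 w]
      congr 1
      field_simp
      ring
    refine ⟨T, hT, hS, (hT.isStarNormal_iff hS).2 fun z w => ?_⟩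
    rw [conj_mul_mul_inv_eq halt h1 h2, mul_comm (ψ (star (α • w))), mul_comm (φ _ : ℂ),
      conj_mul_mul_inv_eq halt h1 h2]
    rw [coeff_relation_iff] at h3
    have h4 := congrArg conj h3
    generalize c₁ - α * c₀ ^ 2 = c at h3 h4 ⊢
    simp only [coe_star_smul, map_mul, map_sub, map_add, map_one, Complex.conj_conj] at h3 h4 ⊢
    congr 2
    -- The relation settles the coefficient of `z`, its conjugate that of `conj w`; the rest agrees
    -- by `|α| = 1`.
    linear_combination -z * h3 - conj (w : ℂ) * h4 + (c₀ * conj (w : ℂ) + z * conj c₀ +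
      z * conj (w : ℂ) * c * conj c -
        z * c₀ * conj c₀ * conj (w : ℂ) * (conj (α : ℂ) * α)) * hα
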